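/- Let $L$ be a real vector space (of arbitrary, possibly infinite, dimension) with a bilinear map $[\cdot,\cdot]:L\times L\to\mathbb{R}$ such that the antisymmetric form $\omega(\xi,\xi')=\frac12[\xi,\xi']-\frac12[\xi',\xi]$ is non-degenerate (if $\omega(\xi,\xi')=0$ for all $\xi'$ then $\xi=0$). Put $M=\{\tau\in L:[\xi,\tau]=0\ \forall\xi\in L\}$ and $N=\{\tau\in L:[\tau,\xi]=0\ \forall\xi\in L\}$, and assume $M+N=L$. Let $Q=L/M$ with quotient map $q:L\to Q$; the map $[\cdot,\cdot]$ descends to $L\times Q\to\mathbb{R}$. Let $\Omega:Q\times Q\to\mathbb{C}$ be a symmetric real-bilinear form with positive definite real part that is admissible, i.e.: $Q$ with the inner product $\mathrm{Re}\,\Omega$ is a real separable Hilbert space; $\mathrm{Im}\,\Omega$ is continuous for its topology; for every $\xi\in L$ the map $\phi\mapsto[\xi,\phi]$ is continuous on $Q$; and every continuous linear map $Q\to\mathbb{R}$ is of the form $\phi\mapsto[\xi,\phi]$ for some $\xi\in L$. Let $Q^*$ be the topological dual of $Q$ and let $\hat Q$ be the algebraic dual of $Q^*$, with the $\sigma$-algebra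 generated by the evaluations $\Phi\mapsto\Phi(l)$, $l\in Q^*$. For each closed subspace $W\subseteq Q$ of finite codimension there is a canonical projection $p_W:\hat Q\to Q/W$, characterized by $m(p_W(\Phi))=\Phi(m\circ\pi_W)$ for all linear $m:Q/W\to\mathbb{R}$, where $\pi_W:Q\to Q/W$ is the quotient map. Then there is a unique measure $\nu_Q$ on $\hat Q$ such that, for every such $W$, the image of $\nu_Q$ under $p_W$ is the probability measure $\exp(-\|x\|^2)\,\mathrm{d}\mu_W(x)$, where $\|\cdot\|$ is the quotient norm on $Q/W$ and $\mu_W$ is the suitably normalized Lebesgue measure. Let $\mathcal{H}^{\tilde S}=L^2(\hat Q,\nu_Q)$ (complex-valued functions). For $\tau\in L$ the reduced wave function of the (normalized) coherent state, $$k_\tau(\phi)=\exp\left(\Omega(q(\tau),\phi)+\mathrm{i}[\tau,\phi]-\tfrac12\Omega(q(\tau),q(\tau))-\tfrac{\mathrm{i}}2[\tau,\tau]\right),\qquad \phi\in Q,$$ is cylindrical, i.e. induced from a function on some quotient $Q/W$ as above, and hence extends canonically, via $p_W$, to a function on $\hat Q$; the extension is obtained by evaluating $\Phi\in\hat Q$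 on the continuous linear functionals $\mathrm{Re}\,\Omega(q(\tau),\cdot)$ and $\mathrm{Im}\,\Omega(q(\tau),\cdot)+[\tau,\cdot]$ in the exponent. These extensions belong to $L^2(\hat Q,\nu_Q)$ for all $\tau\in L$, and their complex linear span is dense in $\mathcal{H}^{\tilde S}=L^2(\hat Q,\nu_Q)$. -/

import Mathlib

open MeasureTheory

noncomputable section

/-! ### Linear field theory -/

/-- A linear field theory on the real vector space `L` of solutions: a bilinear symplectic
potential `[·,·]` whose symplectic form `ω(ξ,ξ') = ½[ξ,ξ'] - ½[ξ',ξ]` is non-degenerate, and such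
that the subspaces `M = {τ | ∀ ξ, [ξ,τ] = 0}` and `N = {τ | ∀ ξ, [τ,ξ] = 0}` generate `L`. -/
structure LinearFieldTheory (L : Type*) [AddCommGroup L] [Module ℝ L] where
  /-- the symplectic potential `[ξ,τ]` -/
  pot : L →ₗ[ℝ] L →ₗ[ℝ] ℝ
  nondegenerate : ∀ ξ : L,
    (∀ ξ' : L, (1 / 2 : ℝ) * pot ξ ξ' - (1 / 2 : ℝ) * pot ξ' ξ = 0) → ξ = 0
  generate : LinearMap.ker pot.flip ⊔ LinearMap.ker pot = ⊤

namespace LinearFieldTheory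

variable {L : Type*} [AddCommGroup L] [Module ℝ L] (S : LinearFieldTheory L)

/-- `M = {τ | ∀ ξ, [ξ,τ] = 0}`. -/
abbrev M : Submodule ℝ L := LinearMap.ker S.pot.flip

/-- The potential as a map `L × L/M → ℝ`. -/
def potQ (ξ : L) : (L ⧸ S.M) →ₗ[ℝ] ℝ :=
  S.M.liftQ (S.pot ξ) fun _ hτ => LinearMap.congr_fun (LinearMap.mem_ker.1 hτ) ξ

/-- A symmetric bilinear form `Ω : Q × Q → ℂ` on `Q = L/M` with positive definite real part. -/
structure VacuumForm where
  /-- the bilinear form -/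
  Om : (L ⧸ S.M) →ₗ[ℝ] (L ⧸ S.M) →ₗ[ℝ] ℂ
  symm : ∀ φ φ', Om φ φ' = Om φ' φ
  re_pos : ∀ φ, φ ≠ 0 → 0 < (Om φ φ).re

namespace VacuumForm

variable {S} (V : S.VacuumForm)

/-- The configuration space `Q = L/M`, to be endowed with the inner product `Re Ω`. -/
def Q (_V : S.VacuumForm) : Type _ := L ⧸ S.M

instance instAddCommGroupQ : AddCommGroup V.Q := inferInstanceAs (AddCommGroup (L ⧸ S.M))

instance instModuleQ : Module ℝ V.Q := inferInstanceAs (Module ℝ (L ⧸ S.M))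

/-- The real part of `Ω` as an inner product on `Q`. -/
@[reducible]
def core : InnerProductSpace.Core ℝ V.Q where
  inner φ φ' := (V.Om φ φ').re
  conj_inner_symm φ φ' := by
    exact congrArg Complex.re (V.symm φ' φ)
  re_inner_nonneg φ := by
    change 0 ≤ (V.Om φ φ).re
    by_cases h : φ = 0
    · have h0 : V.Om φ φ = 0 := by rw [h]; exact LinearMap.map_zero₂ V.Om _
      rw [h0]; simp
    · exact (V.re_pos φ h).le
  add_left φ χ ψ := by
    have h : V.Om (φ + χ) ψ = V.Om φ ψ + V.Om χ ψ := LinearMap.map_add₂ V.Om φ χ ψ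
    rw [h, Complex.add_re]
  smul_left φ ψ r := by
    have h : V.Om (r • φ) ψ = r • V.Om φ ψ := LinearMap.map_smul₂ V.Om r φ ψ
    rw [h, Complex.smul_re]
    rfl
  definite φ h := by
    by_contra h0
    exact (V.re_pos φ h0).ne' h

instance instNormedAddCommGroupQ : NormedAddCommGroup V.Q :=
  @InnerProductSpace.Core.toNormedAddCommGroup ℝ V.Q _ _ _ V.core

instance instInnerProductSpaceQ : InnerProductSpace ℝ V.Q :=
  InnerProductSpace.ofCore V.core.toCore

/-- The quotient map `q : L → Q`. -/
def q : L →ₗ[ℝ] V.Q := S.M.mkQ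

/-- `Ω`, as a form on `Q`. -/
def form : V.Q →ₗ[ℝ] V.Q →ₗ[ℝ] ℂ := V.Om

/-- The functional `φ ↦ [ξ,φ]` on `Q`. -/
def bracket (ξ : L) : V.Q →ₗ[ℝ] ℝ := S.potQ ξ

/-- Admissibility of `Ω`. Topological notions on `Q` refer to the inner product `Re Ω`. -/
structure Admissible : Prop where
  complete : CompleteSpace V.Q
  separable : TopologicalSpace.SeparableSpace V.Q
  im_continuous : Continuous fun p : V.Q × V.Q => (V.form p.1 p.2).im
  bracket_continuous : ∀ ξ : L, Continuous fun φ : V.Q => V.bracket ξ φ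
  bracket_surjective : ∀ l : V.Q →L[ℝ] ℝ, ∃ ξ : L, ∀ φ, l φ = V.bracket ξ φ

end VacuumForm

end LinearFieldTheory

/-! ### The extension `Q̂` and its Gaussian measure -/

section Hat

variable (Q : Type*) [NormedAddCommGroup Q] [NormedSpace ℝ Q]

/-- `Q̂`, the algebraic dual of the topological dual of `Q`. -/
def HatSpace : Type _ := Module.Dual ℝ (Q →L[ℝ] ℝ)

instance HatSpace.instAddCommGroup : AddCommGroup (HatSpace Q) :=
  inferInstanceAs (AddCommGroup (Module.Dual ℝ (Q →L[ℝ] ℝ)))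

instance HatSpace.instModule : Module ℝ (HatSpace Q) :=
  inferInstanceAs (Module ℝ (Module.Dual ℝ (Q →L[ℝ] ℝ)))

variable {Q}

/-- Evaluation of `Φ ∈ Q̂` on a continuous linear functional. -/
def HatSpace.ev (l : Q →L[ℝ] ℝ) (Φ : HatSpace Q) : ℝ :=
  (show Module.Dual ℝ (Q →L[ℝ] ℝ) from Φ) l

/-- The σ-algebra generated by the cylinder sets. -/
instance HatSpace.instMeasurableSpace : MeasurableSpace (HatSpace Q) :=
  ⨆ l : Q →L[ℝ] ℝ, MeasurableSpace.comap (HatSpace.ev l) inferInstance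

/-- The projection of `Q̂` onto a finite-dimensional quotient `Q/W`, i.e. the map dual to
`(Q/W)^* → Q^*`, using that the finite-dimensional space `Q/W` is its own bidual. -/
def HatSpace.proj (W : Submodule ℝ Q) [IsClosed (W : Set Q)] [FiniteDimensional ℝ (Q ⧸ W)]
    (Φ : HatSpace Q) : Q ⧸ W :=
  (Module.evalEquiv ℝ (Q ⧸ W)).symm
    { toFun := fun m => HatSpace.ev ((LinearMap.toContinuousLinearMap m).comp W.mkQL) Φ
      map_add' := fun m m' => by
        have h : (LinearMap.toContinuousLinearMap (m + m')).comp W.mkQL =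
            (LinearMap.toContinuousLinearMap m).comp W.mkQL +
              (LinearMap.toContinuousLinearMap m').comp W.mkQL := by
          ext x; simp
        rw [h]
        exact map_add (show Module.Dual ℝ (Q →L[ℝ] ℝ) from Φ) _ _
      map_smul' := fun r m => by
        have h : (LinearMap.toContinuousLinearMap (r • m)).comp W.mkQL =
            r • (LinearMap.toContinuousLinearMap m).comp W.mkQL := by
          ext x; simp
        rw [h]
        exact map_smul (show Module.Dual ℝ (Q →L[ℝ] ℝ) from Φ) _ _ }

end Hat

/-- The Gaussian probability measure `exp(-‖x‖²) dμ(x)` on a finite-dimensional space, with `μ` the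
Lebesgue measure normalized so that the total mass is one. -/
def normGaussian (E : Type*) [NormedAddCommGroup E] [NormedSpace ℝ E] [FiniteDimensional ℝ E]
    [MeasurableSpace E] [BorelSpace E] : Measure E :=
  (∫⁻ x : E, ENNReal.ofReal (Real.exp (-‖x‖ ^ 2)) ∂Measure.addHaar)⁻¹ •
    (Measure.addHaar : Measure E).withDensity fun x => ENNReal.ofReal (Real.exp (-‖x‖ ^ 2))

/-- `ν` is the projective limit of the Gaussian measures on the finite-dimensional quotients `Q/W`
(with the quotient norm), where `W` runs through the closed subspaces of finite codimension. -/
def IsGaussianLimit {Q : Type*} [NormedAddCommGroup Q] [NormedSpace ℝ Q]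
    (ν : Measure (HatSpace Q)) : Prop :=
  ∀ (W : Submodule ℝ Q) [IsClosed (W : Set Q)] [FiniteDimensional ℝ (Q ⧸ W)],
    letI : MeasurableSpace (Q ⧸ W) := borel (Q ⧸ W)
    haveI : BorelSpace (Q ⧸ W) := ⟨rfl⟩
    ν.map (HatSpace.proj W) = normGaussian (Q ⧸ W)

/-- `F` on `Q̂` is the canonical extension of the cylindrical function `f` on `Q`: both are induced
from the same function on a finite-dimensional quotient. -/
def IsCylindricalExtension {Q : Type*} [NormedAddCommGroup Q] [NormedSpace ℝ Q]
    (f : Q → ℂ) (F : HatSpace Q → ℂ) : Prop :=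
  ∃ (W : Submodule ℝ Q) (_ : IsClosed (W : Set Q)) (_ : FiniteDimensional ℝ (Q ⧸ W))
    (h : Q ⧸ W → ℂ), (∀ φ, f φ = h (W.mkQ φ)) ∧ ∀ Φ, F Φ = h (HatSpace.proj W Φ)

/-! ### Coherent states -/

namespace LinearFieldTheory.VacuumForm

variable {L : Type*} [AddCommGroup L] [Module ℝ L] {S : LinearFieldTheory L} {V : S.VacuumForm}

/-- The reduced wave function of the normalized coherent state associated with `τ ∈ L`,
`k_τ(φ) = exp(Ω(q τ,φ) + i[τ,φ] - ½Ω(q τ,q τ) - (i/2)[τ,τ])`. -/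
def redCoherent (V : S.VacuumForm) (τ : L) (φ : V.Q) : ℂ :=
  Complex.exp (V.form (V.q τ) φ + Complex.I * (V.bracket τ φ : ℂ)
    - (1 / 2 : ℂ) * V.form (V.q τ) (V.q τ) - Complex.I / 2 * (S.pot τ τ : ℂ))

/-- The continuous functional `Re Ω(q τ,·)`. -/
def reL (V : S.VacuumForm) (τ : L) : V.Q →L[ℝ] ℝ := innerSL ℝ (V.q τ)

/-- The continuous functional `Im Ω(q τ,·) + [τ,·]`. -/
def imL (hV : V.Admissible) (τ : L) : V.Q →L[ℝ] ℝ where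
  toLinearMap := Complex.imLm ∘ₗ V.form (V.q τ) + V.bracket τ
  cont := (hV.im_continuous.comp (Continuous.prodMk_right (V.q τ))).add (hV.bracket_continuous τ)

/-- The reduced wave function `k_τ`, canonically extended to `Q̂`: the functional
`Ω(q τ,·) + i[τ,·]` in the exponent is evaluated on `Φ ∈ Q̂`. -/
def redCoherentHat (hV : V.Admissible) (τ : L) (Φ : HatSpace V.Q) : ℂ :=
  Complex.exp ((HatSpace.ev (V.reL τ) Φ : ℂ) + Complex.I * (HatSpace.ev (imL hV τ) Φ : ℂ)
    - (1 / 2 : ℂ) * V.form (V.q τ) (V.q τ) - Complex.I / 2 * (S.pot τ τ : ℂ))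

end LinearFieldTheory.VacuumForm

end

/-! Everything rests on the characteristic functional `l ↦ ∫ exp(i Φ(l)) dν`. It determines a finite
measure on `Q̂`, because the σ-algebra is pulled back from the product `ℝ^(Q^*)` and finite
marginals are determined by their Fourier transforms (`ext_of_charFunctional`). Being the Gaussian
limit is equivalent to having characteristic functional `exp(-‖l‖²/4)`, which gives uniqueness. For
existence, an isonormal process built from i.i.d. Gaussians is made exactly linear by means of a
Hamel basis of `Q^*`.

For density, take `τ ∈ M`: then `q τ = 0` and `[τ,τ] = 0`, so `k_τ` is the pure character
`exp(i[τ,·])`. Since `M + N = L` and `N` does not contribute to the bracket, every character arises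
in this way (`exists_redCoherentHat_eq_exp`). A vector orthogonal to all coherent states thus has
vanishing Fourier coefficients, hence is zero, again by injectivity of the characteristic
functional. -/

namespace HatSpace

/-! ### Measurability and characteristic functionals on `Q̂` -/

section Basic

variable {Q : Type*} [NormedAddCommGroup Q] [NormedSpace ℝ Q]

lemma ev_smul (r : ℝ) (l : Q →L[ℝ] ℝ) (Φ : HatSpace Q) : ev (r • l) Φ = r * ev l Φ :=
  map_smul (show Module.Dual ℝ (Q →L[ℝ] ℝ) from Φ) r l

lemma ev_neg (l : Q →L[ℝ] ℝ) (Φ : HatSpace Q) : ev (-l) Φ = -ev l Φ :=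
  map_neg (show Module.Dual ℝ (Q →L[ℝ] ℝ) from Φ) l

lemma ev_zero (Φ : HatSpace Q) : ev (0 : Q →L[ℝ] ℝ) Φ = 0 :=
  map_zero (show Module.Dual ℝ (Q →L[ℝ] ℝ) from Φ)

lemma ev_sum {ι : Type*} (s : Finset ι) (l : ι → Q →L[ℝ] ℝ) (Φ : HatSpace Q) :
    ev (∑ i ∈ s, l i) Φ = ∑ i ∈ s, ev (l i) Φ :=
  map_sum (show Module.Dual ℝ (Q →L[ℝ] ℝ) from Φ) l s

lemma measurable_ev (l : Q →L[ℝ] ℝ) : Measurable (ev l) := by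
  rw [measurable_iff_comap_le]
  exact le_iSup (fun l : Q →L[ℝ] ℝ => MeasurableSpace.comap (ev l) inferInstance) l

lemma measurable_of_ev {α : Type*} [MeasurableSpace α] {f : α → HatSpace Q}
    (hf : ∀ l : Q →L[ℝ] ℝ, Measurable fun a => ev l (f a)) : Measurable f := by
  rw [measurable_iff_comap_le, instMeasurableSpace, MeasurableSpace.comap_iSup]
  refine iSup_le fun l => ?_
  rw [MeasurableSpace.comap_comp]
  exact (hf l).comap_le

/-- A point of `Q̂` as the family of its values. -/
def evPi (Φ : HatSpace Q) : (Q →L[ℝ] ℝ) → ℝ := fun l => ev l Φ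

lemma measurable_evPi : Measurable (evPi : HatSpace Q → _) :=
  measurable_pi_lambda _ measurable_ev

/-- Allows measures on `Q̂` to be compared after pushing forward to the product, although `evPi`
only reaches the linear families. -/
lemma exists_preimage_evPi {s : Set (HatSpace Q)} (hs : MeasurableSet s) :
    ∃ t, MeasurableSet t ∧ evPi ⁻¹' t = s := by
  have h : (instMeasurableSpace : MeasurableSpace (HatSpace Q)) =
      MeasurableSpace.comap evPi MeasurableSpace.pi := by
    rw [MeasurableSpace.pi, MeasurableSpace.comap_iSup]
    simp_rw [MeasurableSpace.comap_comp]
    rfl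
  rw [h] at hs
  exact hs

/-- The projection is characterized by its compatibility with linear functionals. -/
lemma apply_proj (W : Submodule ℝ Q) [IsClosed (W : Set Q)] [FiniteDimensional ℝ (Q ⧸ W)]
    (m : (Q ⧸ W) →ₗ[ℝ] ℝ) (Φ : HatSpace Q) :
    m (proj W Φ) = ev ((LinearMap.toContinuousLinearMap m).comp W.mkQL) Φ := by
  rw [proj, Module.apply_evalEquiv_symm_apply]
  rfl

lemma finiteDimensional_quotient_ker {F : Type*} [AddCommGroup F] [Module ℝ F]
    [FiniteDimensional ℝ F] (f : Q →ₗ[ℝ] F) : FiniteDimensional ℝ (Q ⧸ LinearMap.ker f) :=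
  Module.Finite.equiv f.quotKerEquivRange.symm

lemma ev_eq_liftQ_proj (W : Submodule ℝ Q) [IsClosed (W : Set Q)]
    [FiniteDimensional ℝ (Q ⧸ W)] (l : Q →L[ℝ] ℝ) (hl : W ≤ LinearMap.ker l.toLinearMap)
    (Φ : HatSpace Q) : ev l Φ = W.liftQ l.toLinearMap hl (proj W Φ) := by
  rw [apply_proj]
  rfl

lemma measurable_proj (W : Submodule ℝ Q) [IsClosed (W : Set Q)] [FiniteDimensional ℝ (Q ⧸ W)]
    [MeasurableSpace (Q ⧸ W)] [BorelSpace (Q ⧸ W)] : Measurable (proj W) := by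
  let b := Module.finBasis ℝ (Q ⧸ W)
  have h : (proj W) = fun Φ => ∑ j,
      ev ((LinearMap.toContinuousLinearMap (b.coord j)).comp W.mkQL) Φ • b j := by
    ext1 Φ
    conv_lhs => rw [← b.sum_repr (proj W Φ)]
    refine Finset.sum_congr rfl fun j _ => ?_
    rw [← apply_proj, b.coord_apply]
  have : ProperSpace (Q ⧸ W) := FiniteDimensional.proper_real _
  rw [h]
  exact Finset.measurable_sum _ fun j _ => (measurable_ev _).smul_const _

/-- The characteristic functional of a measure on `Q̂`. -/
noncomputable def charFunctional (μ : Measure (HatSpace Q)) (l : Q →L[ℝ] ℝ) : ℂ :=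
  ∫ Φ, Complex.exp (ev l Φ * Complex.I) ∂μ

/-- Finite measures on `Q̂` are determined by their characteristic functionals. -/
theorem ext_of_charFunctional {μ ν : Measure (HatSpace Q)} [IsFiniteMeasure μ] [IsFiniteMeasure ν]
    (h : ∀ l, charFunctional μ l = charFunctional ν l) : μ = ν := by
  have hpi : μ.map evPi = ν.map evPi := by
    refine IsProjectiveLimit.unique (P := fun I => (μ.map evPi).map I.restrict)
      (fun I => rfl) fun I => ?_
    classical
    -- By linearity of `Φ`, a functional of finitely many values of `Φ` is a single evaluation, at a
    -- linear combination of the indices.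
    have key : ∀ (ρ : Measure (HatSpace Q)) (m : StrongDual ℝ (I → ℝ)),
        charFunDual ((ρ.map evPi).map I.restrict) m =
          charFunctional ρ (∑ i : I, m (Pi.single i 1) • (i : Q →L[ℝ] ℝ)) := by
      intro ρ m
      rw [charFunDual_apply, Measure.map_map (Finset.measurable_restrict I) measurable_evPi,
        integral_map ((Finset.measurable_restrict I).comp measurable_evPi).aemeasurable
          (by fun_prop), charFunctional]
      congr 1 with Φ
      congr 3
      rw [ev_sum]
      conv_lhs => rw [← m.sum_comp_single]
      refine Finset.sum_congr rfl fun i _ => ?_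
      rw [ev_smul]
      have : (Pi.single i ((I.restrict ∘ evPi) Φ i) : I → ℝ) =
          ev (i : Q →L[ℝ] ℝ) Φ • Pi.single i 1 := by
        rw [← Pi.single_smul]; simp [evPi]
      rw [ContinuousLinearMap.comp_apply, ContinuousLinearMap.single_apply, this, map_smul,
        smul_eq_mul, mul_comm]
    refine Measure.ext_of_charFunDual (funext fun m => ?_)
    rw [key, key, h]
  ext s hs
  obtain ⟨t, ht, rfl⟩ := exists_preimage_evPi hs
  rw [← Measure.map_apply measurable_evPi ht, hpi, Measure.map_apply measurable_evPi ht]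

end Basic

end HatSpace

/-! ### The Gaussian on a finite-dimensional Euclidean space -/

section NormGaussian

variable {E : Type*} [NormedAddCommGroup E] [InnerProductSpace ℝ E] [FiniteDimensional ℝ E]
  [MeasurableSpace E] [BorelSpace E]

lemma integrable_exp_neg_sq_norm :
    Integrable (fun x : E => Real.exp (-‖x‖ ^ 2)) Measure.addHaar := by
  rw [Measure.isAddLeftInvariant_eq_smul (Measure.addHaar : Measure E) volume]
  refine Integrable.smul_measure ?_ (by simp)
  -- A nonzero Bochner integral forces integrability.
  have h : ∫ v : E, Real.exp (-1 * ‖v‖ ^ 2) ≠ 0 := by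
    rw [GaussianFourier.integral_rexp_neg_mul_sq_norm one_pos]
    positivity
  simpa using Integrable.of_integral_ne_zero h

lemma lintegral_exp_neg_sq_norm_ne_zero :
    ∫⁻ x : E, ENNReal.ofReal (Real.exp (-‖x‖ ^ 2)) ∂Measure.addHaar ≠ 0 := by
  rw [← pos_iff_ne_zero, lintegral_pos_iff_support (by fun_prop)]
  have h : (Function.support fun x : E => ENNReal.ofReal (Real.exp (-‖x‖ ^ 2))) = Set.univ := by
    ext x; simp [Real.exp_pos]
  rw [h]
  exact Measure.measure_univ_pos.2 (NeZero.ne _)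

lemma lintegral_exp_neg_sq_norm_ne_top :
    ∫⁻ x : E, ENNReal.ofReal (Real.exp (-‖x‖ ^ 2)) ∂Measure.addHaar ≠ ⊤ :=
  integrable_exp_neg_sq_norm.lintegral_lt_top.ne

instance isProbabilityMeasure_normGaussian : IsProbabilityMeasure (normGaussian E) := by
  constructor
  rw [normGaussian, Measure.smul_apply, withDensity_apply _ .univ, setLIntegral_univ, smul_eq_mul,
    ENNReal.inv_mul_cancel lintegral_exp_neg_sq_norm_ne_zero lintegral_exp_neg_sq_norm_ne_top]

theorem charFunDual_normGaussian (m : StrongDual ℝ E) :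
    charFunDual (normGaussian E) m = Complex.exp (-(‖m‖ ^ 2 / 4 : ℝ)) := by
  have : CompleteSpace E := FiniteDimensional.complete ℝ E
  set w := (InnerProductSpace.toDual ℝ E).symm m with hw
  have hwm : ‖w‖ = ‖m‖ := LinearIsometryEquiv.norm_map _ _
  have hm : ∀ x, m x = inner ℝ w x := fun x => by
    rw [hw, InnerProductSpace.toDual_symm_apply]
  set c := Measure.addHaarScalarFactor (Measure.addHaar : Measure E) volume with hc
  have hvol : (Measure.addHaar : Measure E) = c • volume :=
    Measure.isAddLeftInvariant_eq_smul _ _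
  -- The case `a = 0` is the normalization and `a = i` the Fourier transform; the unknown Haar
  -- factor `c` cancels in the quotient.
  have hI : ∀ a : ℂ, ∫ x, Complex.exp (-‖x‖ ^ 2 + a * (inner ℝ w x : ℝ))
      ∂(Measure.addHaar : Measure E) =
      (c : ℂ) * ((Real.pi : ℂ) ^ (Module.finrank ℝ E / 2 : ℂ)
        * Complex.exp (a ^ 2 * ‖w‖ ^ 2 / 4)) := by
    intro a
    have := GaussianFourier.integral_cexp_neg_mul_sq_norm_add (b := 1) (by simp) a w
    rw [hvol, integral_smul_nnreal_measure]
    simp only [neg_mul, one_mul, div_one, mul_one] at this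
    rw [this, NNReal.smul_def, Complex.real_smul]
  have h0 : ((∫⁻ x : E, ENNReal.ofReal (Real.exp (-‖x‖ ^ 2)) ∂Measure.addHaar).toReal : ℂ) =
      (c : ℂ) * (Real.pi : ℂ) ^ (Module.finrank ℝ E / 2 : ℂ) := by
    rw [← integral_eq_lintegral_of_nonneg_ae (.of_forall fun x => by positivity) (by fun_prop),
      ← integral_complex_ofReal]
    simpa using hI 0
  have hne : (c : ℂ) * (Real.pi : ℂ) ^ (Module.finrank ℝ E / 2 : ℂ) ≠ 0 := by
    rw [← h0]
    exact_mod_cast ENNReal.toReal_ne_zero.2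
      ⟨lintegral_exp_neg_sq_norm_ne_zero, lintegral_exp_neg_sq_norm_ne_top⟩
  rw [charFunDual_apply, normGaussian, integral_smul_measure,
    integral_withDensity_eq_integral_toReal_smul (by fun_prop) (.of_forall fun _ => by simp)]
  have h1 : ∀ x : E, (ENNReal.ofReal (Real.exp (-‖x‖ ^ 2))).toReal •
      Complex.exp (m x * Complex.I) =
      Complex.exp (-‖x‖ ^ 2 + Complex.I * (inner ℝ w x : ℝ)) := by
    intro x
    rw [ENNReal.toReal_ofReal (by positivity), hm, Complex.real_smul, Complex.ofReal_exp,
      ← Complex.exp_add]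
    push_cast
    ring_nf
  simp_rw [h1]
  rw [hI, ENNReal.toReal_inv, Complex.real_smul, Complex.ofReal_inv, h0, ← mul_assoc, ← mul_assoc,
    mul_assoc _ (c : ℂ), inv_mul_cancel₀ hne, one_mul, hwm]
  congr 1
  simp
  ring

end NormGaussian

/-! ### Gaussian limits and their characteristic functional -/

section Quotient

variable {Q : Type*} [NormedAddCommGroup Q] [InnerProductSpace ℝ Q]

lemma IsGaussianLimit.isProbabilityMeasure {ν : Measure (HatSpace Q)} (hν : IsGaussianLimit ν) :
    IsProbabilityMeasure ν := by
  -- The quotient by `W = ⊤` is a point, whose marginal records the total mass.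
  have h : IsClosed ((⊤ : Submodule ℝ Q) : Set Q) := isClosed_univ
  let : MeasurableSpace (Q ⧸ (⊤ : Submodule ℝ Q)) := borel _
  have : BorelSpace (Q ⧸ (⊤ : Submodule ℝ Q)) := ⟨rfl⟩
  have h1 : (ν.map (HatSpace.proj ⊤)) Set.univ = 1 := by
    rw [hν ⊤]
    exact measure_univ
  rw [Measure.map_apply (HatSpace.measurable_proj ⊤) .univ, Set.preimage_univ] at h1
  exact ⟨h1⟩

variable [CompleteSpace Q]

/-- Each class has a representative in `Wᗮ` of the same norm. This makes the marginal transforms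
`exp(-‖m‖²/4)` consistent as `W` varies. -/
lemma norm_comp_mkQL (W : Submodule ℝ Q) [hW : IsClosed (W : Set Q)] (m : StrongDual ℝ (Q ⧸ W)) :
    ‖m.comp W.mkQL‖ = ‖m‖ := by
  have : CompleteSpace W := hW.completeSpace_coe
  refine le_antisymm ?_ ?_
  · refine ContinuousLinearMap.opNorm_le_bound _ (ContinuousLinearMap.opNorm_nonneg _) fun x => ?_
    refine (m.le_opNorm _).trans ?_
    gcongr
    exact Submodule.Quotient.norm_mk_le W x
  · refine ContinuousLinearMap.opNorm_le_bound _ (ContinuousLinearMap.opNorm_nonneg _) fun x => ?_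
    let y := W.quotientEquivOrthogonal x
    have hy : W.mkQL (y : Q) = x := by
      have := W.quotientEquivOrthogonal_symm_eq_mk (y : Q) y.2
      rw [show (⟨(y : Q), y.2⟩ : Wᗮ) = W.quotientEquivOrthogonal x from rfl,
        LinearIsometryEquiv.symm_apply_apply] at this
      exact this.symm
    have hn : ‖(y : Q)‖ = ‖x‖ := W.quotientEquivOrthogonal.norm_map x
    have := (m.comp W.mkQL).le_opNorm (y : Q)
    rwa [hn, ContinuousLinearMap.comp_apply, hy] at this

/-- The Gaussian characteristic functional identifies the projective limit. -/
theorem isGaussianLimit_of_charFunctional {ν : Measure (HatSpace Q)} [IsProbabilityMeasure ν]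
    (h : ∀ l, HatSpace.charFunctional ν l = Complex.exp (-(‖l‖ ^ 2 / 4 : ℝ))) :
    IsGaussianLimit ν := by
  intro W hW _
  let : MeasurableSpace (Q ⧸ W) := borel (Q ⧸ W)
  have : BorelSpace (Q ⧸ W) := ⟨rfl⟩
  have : CompleteSpace W := hW.completeSpace_coe
  have : ProperSpace (Q ⧸ W) := FiniteDimensional.proper_real _
  have hp : Measurable (HatSpace.proj W) := HatSpace.measurable_proj W
  have := Measure.isProbabilityMeasure_map (μ := ν) hp.aemeasurable
  refine Measure.ext_of_charFunDual (funext fun m => ?_)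
  rw [charFunDual_normGaussian, ← norm_comp_mkQL W m, ← h, charFunDual_apply,
    integral_map hp.aemeasurable (by fun_prop), HatSpace.charFunctional]
  congr 1 with Φ
  congr 3
  exact HatSpace.apply_proj W m.toLinearMap Φ

/-- The functional `l` factors through `Q/ker l`, so a single marginal suffices. -/
theorem IsGaussianLimit.charFunctional_eq {ν : Measure (HatSpace Q)} (hν : IsGaussianLimit ν)
    (l : Q →L[ℝ] ℝ) : HatSpace.charFunctional ν l = Complex.exp (-(‖l‖ ^ 2 / 4 : ℝ)) := by
  let W := LinearMap.ker l.toLinearMap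
  have hW : IsClosed (W : Set Q) := l.isClosed_ker
  have hf : FiniteDimensional ℝ (Q ⧸ W) := HatSpace.finiteDimensional_quotient_ker _
  let : MeasurableSpace (Q ⧸ W) := borel (Q ⧸ W)
  have : BorelSpace (Q ⧸ W) := ⟨rfl⟩
  have : CompleteSpace W := hW.completeSpace_coe
  let m : StrongDual ℝ (Q ⧸ W) := LinearMap.toContinuousLinearMap (W.liftQ l.toLinearMap le_rfl)
  have hm : m.comp W.mkQL = l := rfl
  have h := charFunDual_normGaussian m
  rw [← hν W, charFunDual_apply,
    integral_map (HatSpace.measurable_proj W).aemeasurable (by fun_prop),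
    ← norm_comp_mkQL, hm] at h
  rw [← h, HatSpace.charFunctional]
  congr 1 with Φ
  congr 3
  exact HatSpace.ev_eq_liftQ_proj W l le_rfl Φ

theorem IsGaussianLimit.map_ev {ν : Measure (HatSpace Q)} (hν : IsGaussianLimit ν)
    (l : Q →L[ℝ] ℝ) :
    ν.map (HatSpace.ev l) = ProbabilityTheory.gaussianReal 0 (‖l‖₊ ^ 2 / 2) := by
  have := hν.isProbabilityMeasure
  have := Measure.isProbabilityMeasure_map (μ := ν) (HatSpace.measurable_ev l).aemeasurable
  refine Measure.ext_of_charFun (funext fun t => ?_)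
  rw [ProbabilityTheory.charFun_gaussianReal, charFun_apply_real,
    integral_map (HatSpace.measurable_ev l).aemeasurable (by fun_prop)]
  have h := hν.charFunctional_eq (t • l)
  simp only [HatSpace.charFunctional, HatSpace.ev_smul, Complex.ofReal_mul] at h
  rw [h, norm_smul]
  congr 1
  simp [mul_pow, ← Complex.ofReal_pow]
  ring

end Quotient

/-! ### The isonormal process and existence of the Gaussian measure -/

section Isonormal

open ProbabilityTheory

/-- The law of a family of independent standard Gaussian variables. -/
noncomputable def iidGaussian (ι : Type*) : Measure (ι → ℝ) :=
  Measure.infinitePi fun _ => gaussianReal 0 1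

instance (ι : Type*) : IsProbabilityMeasure (iidGaussian ι) := by
  unfold iidGaussian; infer_instance

lemma memLp_eval_iidGaussian {ι : Type*} (i : ι) :
    MemLp (fun ω : ι → ℝ => ω i) 2 (iidGaussian ι) :=
  (memLp_id_gaussianReal 2).comp_measurePreserving (measurePreserving_eval_infinitePi _ i)

lemma integral_mul_iidGaussian {ι : Type*} [DecidableEq ι] (i j : ι) :
    ∫ ω : ι → ℝ, ω i * ω j ∂iidGaussian ι = if i = j then 1 else 0 := by
  have hint : ∀ i : ι, ∫ ω : ι → ℝ, ω i ∂iidGaussian ι = 0 := fun i => by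
    have := (measurePreserving_eval_infinitePi (fun _ : ι => gaussianReal 0 1) i)
    have h2 := integral_map (μ := Measure.infinitePi fun _ : ι => gaussianReal 0 1)
      (f := id) this.measurable.aemeasurable (by fun_prop)
    rw [this.map_eq] at h2
    simpa [iidGaussian] using h2.symm
  split_ifs with h
  · subst h
    have := (measurePreserving_eval_infinitePi (fun _ : ι => gaussianReal 0 1) i)
    have h2 := integral_map (μ := Measure.infinitePi fun _ : ι => gaussianReal 0 1)
      (f := fun x : ℝ => x ^ 2) this.measurable.aemeasurable (by fun_prop)
    rw [this.map_eq] at h2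
    have h3 := variance_id_gaussianReal (μ := 0) (v := 1)
    rw [variance_of_integral_eq_zero (by fun_prop) (by simp)] at h3
    simp only [id, Function.eval, NNReal.coe_one] at h2 h3
    rw [h3] at h2
    simp only [iidGaussian, ← pow_two]
    exact h2.symm
  · have hind : iIndepFun (fun (i : ι) (ω : ι → ℝ) => ω i) (iidGaussian ι) :=
      iIndepFun_infinitePi (X := fun _ x => x) fun _ => measurable_id
    have := (hind.indepFun h).integral_fun_mul_eq_mul_integral
      (measurable_pi_apply i).aestronglyMeasurable (measurable_pi_apply j).aestronglyMeasurable
    rw [this, hint, zero_mul]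

lemma orthonormal_eval_iidGaussian (ι : Type*) :
    Orthonormal ℝ fun i : ι => (memLp_eval_iidGaussian i).toLp := by
  classical
  rw [orthonormal_iff_ite]
  intro i j
  rw [L2.inner_def, ← integral_mul_iidGaussian]
  refine integral_congr_ae ?_
  filter_upwards [(memLp_eval_iidGaussian i).coeFn_toLp,
    (memLp_eval_iidGaussian j).coeFn_toLp] with ω h1 h2
  rw [h1, h2]
  simp [mul_comm]

lemma integral_exp_sum_iidGaussian {ι : Type*} (s : Finset ι) (c : ι → ℝ) :
    ∫ ω : ι → ℝ, Complex.exp ((∑ i ∈ s, c i * ω i : ℝ) * Complex.I) ∂iidGaussian ι =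
      Complex.exp (-((∑ i ∈ s, c i ^ 2) / 2 : ℝ)) := by
  have h := integral_restrict_infinitePi (fun _ : ι => gaussianReal 0 1) (s := s)
    (f := fun x : s → ℝ => ∏ i : s, Complex.exp ((c i * x i : ℝ) * Complex.I))
    (Measurable.aestronglyMeasurable (by fun_prop))
  rw [integral_fintype_prod_eq_prod
    (f := fun (i : s) (x : ℝ) => Complex.exp ((c i * x : ℝ) * Complex.I))] at h
  have h1 : ∀ i : s, ∫ x : ℝ, Complex.exp ((c i * x : ℝ) * Complex.I) ∂gaussianReal 0 1 =
      Complex.exp (-(c i ^ 2 / 2 : ℝ)) := fun i => by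
    have := charFun_gaussianReal (μ := 0) (v := 1) (c i)
    rw [charFun_apply_real] at this
    simp only [Complex.ofReal_mul]
    rw [this]
    simp
  simp_rw [h1, ← Complex.exp_sum] at h
  convert h using 1
  · rw [iidGaussian]
    congr 1 with ω
    rw [← Finset.sum_coe_sort, Complex.ofReal_sum, Finset.sum_mul]
    rfl
  · rw [← Finset.sum_coe_sort]
    congr 1
    push_cast
    rw [Finset.sum_neg_distrib, Finset.sum_div]

/-- The map is 1-Lipschitz, since `|e^{ix} - e^{iy}| ≤ |x - y|` and the L¹ norm is at most the L²
norm on a probability space. -/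
lemma continuous_integral_exp_Lp {Ω : Type*} [MeasurableSpace Ω] (P : Measure Ω)
    [IsProbabilityMeasure P] :
    Continuous fun f : Lp ℝ 2 P => ∫ ω, Complex.exp ((f ω : ℝ) * Complex.I) ∂P := by
  have hi : ∀ f : Lp ℝ 2 P, Integrable (fun ω => Complex.exp ((f ω : ℝ) * Complex.I)) P := by
    intro f
    have hf := (Lp.aestronglyMeasurable f).aemeasurable
    refine Integrable.of_bound (AEMeasurable.aestronglyMeasurable (by fun_prop)) 1 ?_
    exact .of_forall fun ω => by rw [Complex.norm_exp_ofReal_mul_I]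
  have key : LipschitzWith 1
      fun f : Lp ℝ 2 P => ∫ ω, Complex.exp ((f ω : ℝ) * Complex.I) ∂P := by
    refine LipschitzWith.of_dist_le_mul fun f g => ?_
    rw [dist_eq_norm, dist_eq_norm, ← integral_sub (hi f) (hi g), NNReal.coe_one, one_mul]
    have hL1 : Integrable (f - g : Lp ℝ 2 P) P := (Lp.memLp (f - g)).integrable (by norm_num)
    calc ‖∫ ω, (Complex.exp ((f ω : ℝ) * Complex.I) - Complex.exp ((g ω : ℝ) * Complex.I)) ∂P‖
        ≤ ∫ ω, ‖(f - g : Lp ℝ 2 P) ω‖ ∂P := by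
          refine norm_integral_le_of_norm_le hL1.norm ?_
          filter_upwards [Lp.coeFn_sub f g] with ω hω
          rw [hω, Pi.sub_apply]
          have : Complex.exp ((f ω : ℝ) * Complex.I) - Complex.exp ((g ω : ℝ) * Complex.I) =
              Complex.exp ((g ω : ℝ) * Complex.I) *
                (Complex.exp (Complex.I * (f ω - g ω : ℝ)) - 1) := by
            rw [mul_sub, ← Complex.exp_add]
            push_cast
            ring_nf
          rw [this, norm_mul, Complex.norm_exp_ofReal_mul_I, one_mul]
          exact Real.norm_exp_I_mul_ofReal_sub_one_le
      _ = (eLpNorm (f - g : Lp ℝ 2 P) 1 P).toReal := by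
          rw [eLpNorm_one_eq_lintegral_enorm, integral_norm_eq_lintegral_enorm
            hL1.aestronglyMeasurable]
      _ ≤ (eLpNorm (f - g : Lp ℝ 2 P) 2 P).toReal :=
          ENNReal.toReal_mono (Lp.memLp (f - g)).2.ne
            (eLpNorm_le_eLpNorm_of_exponent_le (by norm_num) (Lp.aestronglyMeasurable _))
      _ = ‖f - g‖ := (Lp.norm_def _).symm
  exact key.continuous

/-- The isonormal Gaussian process over a real Hilbert space. -/
theorem exists_isonormal (H : Type*) [NormedAddCommGroup H] [InnerProductSpace ℝ H]
    [CompleteSpace H] :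
    ∃ (ι : Set H) (T : H →ₗᵢ[ℝ] Lp ℝ 2 (iidGaussian ι)), ∀ x,
      ∫ ω, Complex.exp ((T x ω : ℝ) * Complex.I) ∂iidGaussian ι =
        Complex.exp (-(‖x‖ ^ 2 / 2 : ℝ)) := by
  classical
  obtain ⟨ι, b, -⟩ := exists_hilbertBasis ℝ H
  let T : H →ₗᵢ[ℝ] Lp ℝ 2 (iidGaussian ι) :=
    (orthonormal_eval_iidGaussian ι).orthogonalFamily.linearIsometry.comp
      b.repr.toLinearIsometry
  have hT : ∀ i, T (b i) = (memLp_eval_iidGaussian i).toLp := fun i => by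
    change (orthonormal_eval_iidGaussian ι).orthogonalFamily.linearIsometry (b.repr (b i)) = _
    rw [b.repr_self, OrthogonalFamily.linearIsometry_apply_single]
    simp
  refine ⟨ι, T, fun x => ?_⟩
  have hd : Dense (Submodule.span ℝ (Set.range b) : Set H) := by
    rw [Submodule.dense_iff_topologicalClosure_eq_top]
    exact b.dense_span
  -- Both sides are continuous in `x`, so finite combinations of the Hilbert basis suffice; there
  -- `T` gives finite sums of independent Gaussians.
  refine congr_fun (Continuous.ext_on hd
    ((continuous_integral_exp_Lp (iidGaussian ι)).comp T.continuous)
    (g := fun x : H => Complex.exp (-(‖x‖ ^ 2 / 2 : ℝ))) (by fun_prop) ?_) x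
  intro y hy
  obtain ⟨c, rfl⟩ := (Finsupp.mem_span_range_iff_exists_finsupp).1 hy
  have hnorm : ‖c.sum fun i a => a • b i‖ ^ 2 = ∑ i ∈ c.support, c i ^ 2 := by
    rw [← real_inner_self_eq_norm_sq, Finsupp.sum, b.orthonormal.inner_sum]
    simp [pow_two]
  have hTc : (T (c.sum fun i a => a • b i) : (ι → ℝ) → ℝ) =ᵐ[iidGaussian ι]
      fun ω => ∑ i ∈ c.support, c i * ω i := by
    rw [Finsupp.sum, map_sum]
    simp_rw [map_smul, hT]
    have h1 : ∀ᵐ ω ∂iidGaussian ι, ∀ i ∈ c.support,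
        (c i • (memLp_eval_iidGaussian i).toLp : Lp ℝ 2 (iidGaussian ι)) ω = c i * ω i := by
      rw [Filter.eventually_all_finset]
      intro i _
      filter_upwards [Lp.coeFn_smul (c i) (memLp_eval_iidGaussian i).toLp,
        (memLp_eval_iidGaussian i).coeFn_toLp] with ω h1 h2
      rw [h1, Pi.smul_apply, h2, smul_eq_mul]
    refine (Lp.coeFn_finsetSum _ _).trans ?_
    filter_upwards [h1] with ω hω
    simp only [Finset.sum_apply]
    exact Finset.sum_congr rfl hω
  simp only [Function.comp_apply]
  rw [hnorm, ← integral_exp_sum_iidGaussian]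
  refine integral_congr_ae ?_
  filter_upwards [hTc] with ω hω
  rw [hω]

end Isonormal

/-- Existence of the Gaussian measure on `Q̂`: a linear version of the isonormal process is obtained
by prescribing it on a Hamel basis of the dual. -/
theorem exists_isGaussianLimit (Q : Type*) [NormedAddCommGroup Q] [InnerProductSpace ℝ Q]
    [CompleteSpace Q] : ∃ ν : Measure (HatSpace Q), IsGaussianLimit ν := by
  obtain ⟨ι, T, hT⟩ := exists_isonormal Q
  -- The factor `1/√2` lowers the variance from `‖l‖²` to the required `‖l‖²/2`.
  let R : StrongDual ℝ Q →ₗ[ℝ] Lp ℝ 2 (iidGaussian ι) :=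
    (√2)⁻¹ • T.toLinearMap ∘ₗ
      { toFun := (InnerProductSpace.toDual ℝ Q).symm
        map_add' := map_add _
        map_smul' := fun r l => by simp }
  have hR : ∀ l, ∫ ω, Complex.exp ((R l ω : ℝ) * Complex.I) ∂iidGaussian ι =
      Complex.exp (-(‖l‖ ^ 2 / 4 : ℝ)) := by
    intro l
    have h1 : R l = T ((√2)⁻¹ • (InnerProductSpace.toDual ℝ Q).symm l) := by
      rw [map_smul]; rfl
    rw [h1, hT, norm_smul, LinearIsometryEquiv.norm_map, mul_pow, norm_inv, Real.norm_eq_abs,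
      abs_of_nonneg (Real.sqrt_nonneg _), inv_pow, Real.sq_sqrt (by norm_num)]
    congr 3
    ring
  let B := Module.Basis.ofVectorSpace ℝ (StrongDual ℝ Q)
  -- Each `R l` is only an a.e. class. Fixing representatives on a Hamel basis makes `Ψ ω` linear
  -- for every `ω`; each `l` involves finitely many basis vectors, so only finitely many null sets
  -- are discarded.
  let Ψ : (ι → ℝ) → HatSpace Q := fun ω => B.constr ℝ fun j => R (B j) ω
  have hΨ : ∀ l ω, HatSpace.ev l (Ψ ω) = (B.repr l).sum fun j a => a * R (B j) ω := fun l ω =>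
    B.constr_apply ℝ _ l
  have hm : Measurable Ψ := by
    refine HatSpace.measurable_of_ev fun l => ?_
    simp_rw [hΨ]
    exact Finset.measurable_sum _ fun j _ =>
      ((Lp.stronglyMeasurable (R (B j))).measurable.const_mul _)
  have hae : ∀ l, (fun ω => HatSpace.ev l (Ψ ω)) =ᵐ[iidGaussian ι] R l := by
    intro l
    simp_rw [hΨ]
    conv_rhs => rw [← B.linearCombination_repr l, Finsupp.linearCombination_apply, Finsupp.sum,
      map_sum]
    simp_rw [map_smul]
    have h1 : ∀ᵐ ω ∂iidGaussian ι, ∀ j ∈ (B.repr l).support,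
        (B.repr l j • R (B j) : Lp ℝ 2 (iidGaussian ι)) ω = B.repr l j * R (B j) ω := by
      rw [Filter.eventually_all_finset]
      intro j _
      exact Lp.coeFn_smul _ _
    filter_upwards [h1, Lp.coeFn_finsetSum (B.repr l).support fun j => B.repr l j • R (B j)]
      with ω hω h2
    rw [h2, Finset.sum_apply]
    exact (Finset.sum_congr rfl hω).symm
  have := Measure.isProbabilityMeasure_map (μ := iidGaussian ι) hm.aemeasurable
  refine ⟨(iidGaussian ι).map Ψ, isGaussianLimit_of_charFunctional fun l => ?_⟩
  have hl := HatSpace.measurable_ev l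
  rw [HatSpace.charFunctional, integral_map hm.aemeasurable (by fun_prop), ← hR]
  refine integral_congr_ae ?_
  filter_upwards [hae l] with ω hω
  rw [hω]

/-! ### Completeness of the characters -/

namespace HatSpace

variable {Q : Type*} [NormedAddCommGroup Q] [NormedSpace ℝ Q]

lemma aestronglyMeasurable_exp_ev (ν : Measure (HatSpace Q)) (l : Q →L[ℝ] ℝ) :
    AEStronglyMeasurable (fun Φ => Complex.exp (ev l Φ * Complex.I)) ν := by
  have := measurable_ev l
  exact Measurable.aestronglyMeasurable (by fun_prop)

/-- A real integrable function all of whose Fourier coefficients vanish is zero. -/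
theorem ae_eq_zero_of_forall_integral_exp_mul {ν : Measure (HatSpace Q)}
    {g : HatSpace Q → ℝ} (hg : Integrable g ν)
    (h : ∀ l : Q →L[ℝ] ℝ, ∫ Φ, (g Φ : ℂ) * Complex.exp (ev l Φ * Complex.I) ∂ν = 0) :
    g =ᵐ[ν] 0 := by
  have hfin : ∀ {f : HatSpace Q → ℝ}, Integrable f ν →
      IsFiniteMeasure (ν.withDensity fun Φ => ENNReal.ofReal (f Φ)) := fun hf =>
    isFiniteMeasure_withDensity_ofReal hf.2
  have := hfin hg
  have := hfin hg.neg
  have hchar : ∀ {f : HatSpace Q → ℝ}, Integrable f ν → ∀ l,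
      charFunctional (ν.withDensity fun Φ => ENNReal.ofReal (f Φ)) l =
        ∫ Φ, (max (f Φ) 0 : ℝ) • Complex.exp (ev l Φ * Complex.I) ∂ν := fun hf l => by
    rw [charFunctional, integral_withDensity_eq_integral_toReal_smul₀
      hf.aestronglyMeasurable.aemeasurable.ennreal_ofReal (.of_forall fun _ => by simp)]
    simp [ENNReal.toReal_ofReal']
  have hint : ∀ {f : HatSpace Q → ℝ}, Integrable f ν → ∀ l,
      Integrable (fun Φ => (max (f Φ) 0 : ℝ) • Complex.exp (ev l Φ * Complex.I)) ν :=
    fun hf l => hf.pos_part.smul_bdd 1 (aestronglyMeasurable_exp_ev ν l)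
      (.of_forall fun Φ => by rw [Complex.norm_exp_ofReal_mul_I])
  -- As `ENNReal.ofReal` truncates at zero, these are the finite measures with densities `g⁺` and
  -- `g⁻`. Their characteristic functionals differ by the Fourier coefficients of `g`, which vanish.
  have heq : (ν.withDensity fun Φ => ENNReal.ofReal (g Φ)) =
      ν.withDensity fun Φ => ENNReal.ofReal ((-g) Φ) := by
    refine ext_of_charFunctional fun l => ?_
    rw [hchar hg, hchar hg.neg, ← sub_eq_zero, ← integral_sub (hint hg l) (hint hg.neg l), ← h l]
    congr 1 with Φ
    rw [← sub_smul, Pi.neg_apply, Complex.real_smul]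
    congr 2
    exact max_zero_sub_eq_self _
  rw [withDensity_eq_iff hg.aestronglyMeasurable.aemeasurable.ennreal_ofReal
    hg.neg.aestronglyMeasurable.aemeasurable.ennreal_ofReal hg.lintegral_lt_top.ne] at heq
  filter_upwards [heq] with Φ hΦ
  rcases le_total (g Φ) 0 with h0 | h0
  · rw [ENNReal.ofReal_of_nonpos h0, eq_comm, ENNReal.ofReal_eq_zero] at hΦ
    exact le_antisymm h0 (by simpa using hΦ)
  · rw [ENNReal.ofReal_of_nonpos (p := (-g) Φ) (by simpa using h0), ENNReal.ofReal_eq_zero] at hΦ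
    exact le_antisymm hΦ h0

/-- A complex integrable function all of whose Fourier coefficients vanish is zero. -/
theorem ae_eq_zero_of_forall_integral_mul_exp {ν : Measure (HatSpace Q)}
    {f : HatSpace Q → ℂ} (hf : Integrable f ν)
    (h : ∀ l : Q →L[ℝ] ℝ, ∫ Φ, f Φ * Complex.exp (ev l Φ * Complex.I) ∂ν = 0) :
    f =ᵐ[ν] 0 := by
  have hint : ∀ {f : HatSpace Q → ℂ}, Integrable f ν → ∀ l,
      Integrable (fun Φ => f Φ * Complex.exp (ev l Φ * Complex.I)) ν := fun hf l =>
    hf.mul_bdd (c := 1) (aestronglyMeasurable_exp_ev ν l)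
      (.of_forall fun Φ => by rw [Complex.norm_exp_ofReal_mul_I])
  have hfc : Integrable (fun Φ => (starRingEnd ℂ) (f Φ)) ν :=
    Complex.conjLIE.integrable_comp_iff.2 hf
  -- The coefficient of the conjugate at `l` is the conjugate of the coefficient of `f` at `-l`, so
  -- real and imaginary parts can be treated separately.
  have hc : ∀ l : Q →L[ℝ] ℝ,
      ∫ Φ, (starRingEnd ℂ) (f Φ) * Complex.exp (ev l Φ * Complex.I) ∂ν = 0 := fun l => by
    have := congrArg (starRingEnd ℂ) (h (-l))
    rw [← integral_conj, map_zero] at this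
    rw [← this]
    congr 1 with Φ
    rw [map_mul, ← Complex.exp_conj, ev_neg]
    simp
  have hre : (fun Φ => (f Φ).re) =ᵐ[ν] 0 := by
    refine ae_eq_zero_of_forall_integral_exp_mul hf.re fun l => ?_
    have h2 : ∫ Φ, ((1 / 2 : ℂ) * (f Φ * Complex.exp (ev l Φ * Complex.I)) +
        (1 / 2 : ℂ) * ((starRingEnd ℂ) (f Φ) * Complex.exp (ev l Φ * Complex.I))) ∂ν = 0 := by
      rw [integral_add ((hint hf l).const_mul _) ((hint hfc l).const_mul _),
        integral_const_mul, integral_const_mul, h, hc]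
      simp
    rw [← h2]
    congr 1 with Φ
    rw [Complex.re_eq_add_conj]
    ring
  have him : (fun Φ => (f Φ).im) =ᵐ[ν] 0 := by
    refine ae_eq_zero_of_forall_integral_exp_mul hf.im fun l => ?_
    have h2 : ∫ Φ, (1 / (2 * Complex.I) * (f Φ * Complex.exp (ev l Φ * Complex.I)) -
        1 / (2 * Complex.I) *
          ((starRingEnd ℂ) (f Φ) * Complex.exp (ev l Φ * Complex.I))) ∂ν = 0 := by
      rw [integral_sub ((hint hf l).const_mul _) ((hint hfc l).const_mul _),
        integral_const_mul, integral_const_mul, h, hc]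
      simp
    rw [← h2]
    congr 1 with Φ
    rw [Complex.im_eq_sub_conj]
    ring
  filter_upwards [hre, him] with Φ h1 h2
  exact Complex.ext h1 h2

end HatSpace

/-! ### Coherent states -/

namespace LinearFieldTheory.VacuumForm

variable {L : Type*} [AddCommGroup L] [Module ℝ L] {S : LinearFieldTheory L} {V : S.VacuumForm}

lemma form_eq (hV : V.Admissible) (τ : L) (φ : V.Q) :
    V.form (V.q τ) φ + Complex.I * (V.bracket τ φ : ℂ) =
      (V.reL τ φ : ℂ) + Complex.I * (imL hV τ φ : ℂ) := by
  have h1 : V.reL τ φ = (V.form (V.q τ) φ).re := rfl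
  have h2 : imL hV τ φ = (V.form (V.q τ) φ).im + V.bracket τ φ := rfl
  rw [h1, h2]
  conv_lhs => rw [← Complex.re_add_im (V.form (V.q τ) φ)]
  push_cast
  ring

theorem isCylindricalExtension_redCoherentHat (hV : V.Admissible) (τ : L) :
    IsCylindricalExtension (V.redCoherent τ) (redCoherentHat hV τ) := by
  -- The exponent depends on only two functionals; their common kernel has codimension at most two.
  let f := (V.reL τ).prod (imL hV τ)
  let W := LinearMap.ker f.toLinearMap
  have hW : IsClosed (W : Set V.Q) := f.isClosed_ker
  have hf : FiniteDimensional ℝ (V.Q ⧸ W) := HatSpace.finiteDimensional_quotient_ker _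
  have h1 : W ≤ LinearMap.ker (V.reL τ).toLinearMap := fun φ hφ => congrArg Prod.fst hφ
  have h2 : W ≤ LinearMap.ker (imL hV τ).toLinearMap := fun φ hφ => congrArg Prod.snd hφ
  refine ⟨W, hW, hf, fun x => Complex.exp ((W.liftQ _ h1 x : ℂ) + Complex.I * (W.liftQ _ h2 x : ℂ)
    - (1 / 2 : ℂ) * V.form (V.q τ) (V.q τ) - Complex.I / 2 * (S.pot τ τ : ℂ)),
    fun φ => ?_, fun Φ => ?_⟩
  · rw [redCoherent, form_eq hV]
    rfl
  · rw [redCoherentHat, HatSpace.ev_eq_liftQ_proj W _ h1, HatSpace.ev_eq_liftQ_proj W _ h2]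

/-- Up to a constant, `|k_τ|²` is the exponential of twice a Gaussian variable, and Gaussians have
all exponential moments. -/
theorem memLp_redCoherentHat (hV : V.Admissible) {ν : Measure (HatSpace V.Q)}
    (hν : IsGaussianLimit ν) (τ : L) : MemLp (redCoherentHat hV τ) 2 ν := by
  have := hV.complete
  have hr := HatSpace.measurable_ev (V.reL τ)
  have hi := HatSpace.measurable_ev (imL hV τ)
  have hm : Measurable (redCoherentHat hV τ) := by
    unfold redCoherentHat
    fun_prop
  rw [memLp_two_iff_integrable_sq_norm hm.aestronglyMeasurable]
  have hexp : Integrable (fun Φ => Real.exp (2 * HatSpace.ev (V.reL τ) Φ)) ν := by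
    have h := ProbabilityTheory.integrable_exp_mul_gaussianReal
      (μ := 0) (v := ‖V.reL τ‖₊ ^ 2 / 2) 2
    rw [← hν.map_ev] at h
    exact h.comp_measurable hr
  set c := - (1 / 2 : ℂ) * V.form (V.q τ) (V.q τ) - Complex.I / 2 * (S.pot τ τ : ℂ) with hc
  refine (hexp.mul_const (Real.exp (2 * c.re))).congr (.of_forall fun Φ => ?_)
  have h1 : redCoherentHat hV τ Φ = Complex.exp ((HatSpace.ev (V.reL τ) Φ : ℂ) +
      (HatSpace.ev (imL hV τ) Φ : ℂ) * Complex.I + c) := by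
    rw [redCoherentHat, hc]
    ring_nf
  simp only
  rw [h1, Complex.norm_exp, ← Real.exp_add, ← Real.exp_nat_mul]
  congr 1
  simp
  ring

/-- Every character of `Q̂` is the coherent state of an element of `M`. -/
lemma exists_redCoherentHat_eq_exp (hV : V.Admissible) (l : V.Q →L[ℝ] ℝ) :
    ∃ τ, ∀ Φ, redCoherentHat hV τ Φ = Complex.exp (HatSpace.ev l Φ * Complex.I) := by
  obtain ⟨ξ, hξ⟩ := hV.bracket_surjective l
  have hmem : ξ ∈ LinearMap.ker S.pot.flip ⊔ LinearMap.ker S.pot := by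
    rw [S.generate]; trivial
  -- Discarding `n ∈ N` leaves the functional `[ξ,·]` unchanged, while `m ∈ M` removes every term
  -- containing `Ω`.
  obtain ⟨m, hm, n, hn, rfl⟩ := Submodule.mem_sup.1 hmem
  have hq : V.q m = 0 := (Submodule.Quotient.mk_eq_zero _).2 hm
  have hre : V.reL m = 0 := by rw [reL, hq, map_zero]
  have him : imL hV m = l := by
    ext φ
    have h2 : imL hV m φ = (V.form (V.q m) φ).im + V.bracket m φ := rfl
    rw [h2, hq, map_zero, LinearMap.zero_apply, Complex.zero_im, zero_add, hξ]
    obtain ⟨x, rfl⟩ := Submodule.mkQ_surjective S.M φ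
    change S.pot m x = S.pot (m + n) x
    rw [map_add, LinearMap.mem_ker.1 hn, add_zero]
  have hp : S.pot m m = 0 := LinearMap.congr_fun (LinearMap.mem_ker.1 hm) m
  refine ⟨m, fun Φ => ?_⟩
  rw [redCoherentHat, hre, him, hq, hp, HatSpace.ev_zero]
  simp [mul_comm]

theorem dense_span_redCoherentHat (hV : V.Admissible) {ν : Measure (HatSpace V.Q)}
    (hν : IsGaussianLimit ν) (hk : ∀ τ : L, MemLp (redCoherentHat hV τ) 2 ν) :
    Dense (Submodule.span ℂ (Set.range fun τ : L => (hk τ).toLp) : Set (Lp ℂ 2 ν)) := by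
  have := hV.complete
  have := hν.isProbabilityMeasure
  rw [Submodule.dense_iff_topologicalClosure_eq_top, Submodule.topologicalClosure_eq_top_iff,
    Submodule.eq_bot_iff]
  intro f hf
  rw [Lp.eq_zero_iff_ae_eq_zero]
  refine HatSpace.ae_eq_zero_of_forall_integral_mul_exp
    ((Lp.memLp f).integrable (by norm_num)) fun l => ?_
  -- The sign compensates the conjugation in the first slot of the inner product.
  obtain ⟨τ, hτ⟩ := exists_redCoherentHat_eq_exp hV (-l)
  have h := (Submodule.mem_orthogonal _ _).1 hf _ (Submodule.subset_span ⟨τ, rfl⟩)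
  rw [L2.inner_def] at h
  rw [← h]
  refine integral_congr_ae ?_
  filter_upwards [(hk τ).coeFn_toLp] with Φ hΦ
  rw [hΦ, hτ, RCLike.inner_apply, ← Complex.exp_conj, HatSpace.ev_neg]
  simp

end LinearFieldTheory.VacuumForm

theorem mainTheorem5 {L : Type*} [AddCommGroup L] [Module ℝ L] (S : LinearFieldTheory L)
    (V : S.VacuumForm) (hV : V.Admissible) :
    (∃! ν : MeasureTheory.Measure (HatSpace V.Q), IsGaussianLimit ν) ∧
    (∀ τ : L, IsCylindricalExtension (V.redCoherent τ)
      (LinearFieldTheory.VacuumForm.redCoherentHat hV τ)) ∧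
    ∀ ν : MeasureTheory.Measure (HatSpace V.Q), IsGaussianLimit ν →
      ∃ hk : ∀ τ : L,
          MeasureTheory.MemLp (LinearFieldTheory.VacuumForm.redCoherentHat hV τ) 2 ν,
        Dense (Submodule.span ℂ (Set.range fun τ : L => (hk τ).toLp) :
          Set (MeasureTheory.Lp ℂ 2 ν)) := by
  have := hV.complete
  obtain ⟨ν, hν⟩ := exists_isGaussianLimit V.Q
  refine ⟨⟨ν, hν, fun μ hμ => ?_⟩,
    LinearFieldTheory.VacuumForm.isCylindricalExtension_redCoherentHat hV, fun μ hμ =>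
    ⟨LinearFieldTheory.VacuumForm.memLp_redCoherentHat hV hμ,
      LinearFieldTheory.VacuumForm.dense_span_redCoherentHat hV hμ _⟩⟩
  have := hν.isProbabilityMeasure
  have := IsGaussianLimit.isProbabilityMeasure hμ
  exact HatSpace.ext_of_charFunctional fun l => by
    rw [hν.charFunctional_eq, IsGaussianLimit.charFunctional_eq hμ]
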